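/- Let $k$ be a field of characteristic zero, let $m\ge 2$, and let $R$ be the polynomial ring over $k$ in the $m^2-1$ variables $x_{i,j}$, $1\le i,j\le m$, $(i,j)\ne(m,m)$. Let $\mathcal{GC}$ be the $m\times m$ matrix whose $(i,j)$ entry is $x_{i,j}$ for $(i,j)\neq(m,m)$ and whose $(m,m)$ entry is $x_{m-1,m-1}$, and let $f=\det\mathcal{GC}\in R$. Then: (i) $f$ is irreducible in $R$. (ii) The Hessian determinant of $f$, i.e. the determinant of the $(m^2-1)\times(m^2-1)$ matrix of second partial derivatives of $f$, is a nonzero polynomial. (iii) The gradient ideal $J\subset R$ of $f$, generated by the partial derivatives of $f$, has linear rank $m^2-2$, the maximum possible. Here, for an ideal minimally generated by $n+1$ forms of the same degree, the linear rank is the rank of the submodule of $R^{n+1}$ generated by those syzygies of a minimal system of such generators whose coordinates are all linear forms (or zero); it does not depend on the system. It is maximal if it equals $n$, the rank of the whole syzygy module. (iv) $f$ is homaloidal, i.e. $f$ is a form of degree at least $2$ and its polar map $\mathbb{P}^{m^2-2}_k\dashrightarrow\mathbb{P}^{m^2-2}_k$, whose coordinates are the partial derivatives of $f$, is a Cremona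 map (a birational map of $\mathbb{P}^{m^2-2}_k$ to itself). -/

import Mathlib

open MvPolynomial

noncomputable section

namespace Cloning

/-! ### Minimal systems of forms and the linear rank of an ideal -/

/-- `g` is a minimal system of generators of the ideal `I`, consisting of forms of the
same degree `s`. -/
structure IsMinimalFormSystem {k σ ι : Type*} [Field k]
    (I : Ideal (MvPolynomial σ k)) (s : ℕ) (g : ι → MvPolynomial σ k) : Prop where
  isHomogeneous : ∀ i, (g i).IsHomogeneous s
  span_eq : Ideal.span (Set.range g) = I
  irredundant : ∀ i, g i ∉ Ideal.span (g '' {j | j ≠ i})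

/-- The module of (first) syzygies of the family `g`. -/
def syzygies {k σ ι : Type*} [Field k] [Fintype ι] (g : ι → MvPolynomial σ k) :
    Submodule (MvPolynomial σ k) (ι → MvPolynomial σ k) :=
  LinearMap.ker (Fintype.linearCombination (MvPolynomial σ k) g)

/-- The submodule generated by the linear syzygies of `g`, i.e. by the syzygies all of whose
coordinates are linear forms (or zero). -/
def linearSyzygies {k σ ι : Type*} [Field k] [Fintype ι] (g : ι → MvPolynomial σ k) :
    Submodule (MvPolynomial σ k) (ι → MvPolynomial σ k) :=
  Submodule.span (MvPolynomial σ k) {c | c ∈ syzygies g ∧ ∀ i, (c i).IsHomogeneous 1}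

/-- The ideal `I`, which is minimally generated by finitely many forms of the same degree, has
linear rank `r`: for each such minimal system of generators the module generated by the linear
syzygies has rank `r`. -/
def HasLinearRank {k σ : Type*} [Field k] (I : Ideal (MvPolynomial σ k)) (r : ℕ) : Prop :=
  (∃ (n s : ℕ) (g : Fin n → MvPolynomial σ k), IsMinimalFormSystem I s g) ∧
    ∀ (n s : ℕ) (g : Fin n → MvPolynomial σ k), IsMinimalFormSystem I s g →
      Module.finrank (MvPolynomial σ k) (linearSyzygies g) = r

/-- The ideal `I` has maximal linear rank: it is minimally generated by `n + 1` forms of the same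
degree, and its linear rank is `n`, the rank of the whole syzygy module. -/
def HasMaximalLinearRank {k σ : Type*} [Field k] (I : Ideal (MvPolynomial σ k)) : Prop :=
  ∃ (n s : ℕ) (g : Fin (n + 1) → MvPolynomial σ k), IsMinimalFormSystem I s g ∧
    Module.finrank (MvPolynomial σ k) (syzygies g) = n ∧ HasLinearRank I n

/-! ### Rational maps between projective spaces -/

/-- `F` is a tuple of forms in the variables `σ`, of the same degree at least one and not all
zero: it defines a rational map from the projective space with coordinates `σ` to the one with
coordinates `τ`. -/
def DefinesRationalMap {k σ τ : Type*} [Field k] (F : τ → MvPolynomial σ k) : Prop :=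
  ∃ d : ℕ, 1 ≤ d ∧ (∀ i, (F i).IsHomogeneous d) ∧ ∃ i, F i ≠ 0

/-- The defining ideal of the image of `F`: the kernel of `k[y] → k[F]`, `y i ↦ F i`. -/
def imageIdeal {k σ τ : Type*} [Field k] (F : τ → MvPolynomial σ k) :
    Ideal (MvPolynomial τ k) :=
  RingHom.ker (aeval F : MvPolynomial τ k →ₐ[k] MvPolynomial σ k)

/-- `F` is birational onto its image: there is a rational map `G`, whose coordinates do not all
vanish modulo the ideal of the image, with `(G(F)) = (x)` as points of projective space. -/
def IsBirationalOntoImage {k σ τ : Type*} [Field k] (F : τ → MvPolynomial σ k) : Prop :=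
  DefinesRationalMap F ∧
    ∃ G : σ → MvPolynomial τ k, DefinesRationalMap G ∧ (∃ i, G i ∉ imageIdeal F) ∧
      ∀ i j, aeval F (G i) * X j = aeval F (G j) * X i

/-- `F` is a Cremona map: a birational map from a projective space to itself, i.e. birational onto
its image, the image being the whole space. -/
def IsCremona {k σ : Type*} [Field k] (F : σ → MvPolynomial σ k) : Prop :=
  IsBirationalOntoImage F ∧ imageIdeal F = ⊥

/-! ### Polar maps -/

/-- The partial derivatives of `f`, the coordinates of its polar map. -/
def polarMap {k σ : Type*} [Field k] (f : MvPolynomial σ k) : σ → MvPolynomial σ k :=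
  fun i => pderiv i f

/-- The gradient (Jacobian) ideal of `f`. -/
def gradientIdeal {k σ : Type*} [Field k] (f : MvPolynomial σ k) : Ideal (MvPolynomial σ k) :=
  Ideal.span (Set.range (polarMap f))

/-- The Hessian matrix of `f`. -/
def hessian {k σ : Type*} [Field k] (f : MvPolynomial σ k) : Matrix σ σ (MvPolynomial σ k) :=
  Matrix.of fun i j => pderiv i (pderiv j f)

/-- `f` is homaloidal: a form of degree at least two whose polar map is a Cremona map. -/
def IsHomaloidal {k σ : Type*} [Field k] (f : MvPolynomial σ k) : Prop :=
  (∃ d : ℕ, 2 ≤ d ∧ f.IsHomogeneous d) ∧ IsCremona (polarMap f)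

/-! ### The cloned generic matrix -/

/-- The index set of the variables: all positions of an `m × m` matrix but the last diagonal one.
Positions are counted from zero. -/
abbrev CloneVar (m : ℕ) : Type :=
  {p : Fin m × Fin m // ¬ (p.1.val + 1 = m ∧ p.2.val + 1 = m)}

/-- The last but one position on the diagonal. -/
def cloneSource (m : ℕ) (hm : 2 ≤ m) : CloneVar m :=
  ⟨(⟨m - 2, by omega⟩, ⟨m - 2, by omega⟩), by
    rintro ⟨h, -⟩
    have h' : m - 2 + 1 = m := h
    omega⟩

/-- The generic `m × m` matrix in which the last but one diagonal entry is cloned into the last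
diagonal slot. -/
def clonedMatrix (k : Type*) [Field k] (m : ℕ) (hm : 2 ≤ m) :
    Matrix (Fin m) (Fin m) (MvPolynomial (CloneVar m) k) :=
  Matrix.of fun i j =>
    if h : i.val + 1 = m ∧ j.val + 1 = m then X (cloneSource m hm) else X ⟨(i, j), h⟩

/-- The determinant of the cloned generic matrix. -/
def clonedDet (k : Type*) [Field k] (m : ℕ) (hm : 2 ≤ m) : MvPolynomial (CloneVar m) k :=
  (clonedMatrix k m hm).det

end Cloning

end

/-!
Taking cofactors twice returns a multiple of the matrix, which inverts the polar map of the generic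
determinant. Here the polar map only remembers the *sum* of the cofactors at the two cloned slots
`(s, s)` and `(l, l)`, so the cofactor matrix `N` is known up to a multiple of `E s s - E l l`, with
`E` the matrix units. The multiple is recovered from the condition that the cofactors of `N` at the
two slots agree: this condition is linear in it, so that the inverse is again rational.

The composite of the polar map with this inverse is `x ↦ h x` for a form `h`, whose Jacobian is
computed by Euler's formula; the chain rule then gives the Hessian. Linear syzygies come from
`M ↦ P M + M Q`: if this preserves the equality of the two cloned entries, then it scales `f` by
`tr (P + Q)`, and the choices of trace zero generate a module of maximal rank. Irreducibility holds
because `f` is linear in its upper right variable.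
-/

namespace Cloning

/-! ### Derivations of products, determinants and polynomials -/

section Derivation

variable {k A : Type*} [CommSemiring k] [CommRing A] [Algebra k A]

theorem derivation_prod {ι : Type*} [DecidableEq ι] (D : Derivation k A A) (s : Finset ι)
    (a : ι → A) :
    D (∏ i ∈ s, a i) = ∑ i ∈ s, ∏ j ∈ s, Function.update a i (D (a i)) j := by
  induction s using Finset.induction_on with
  | empty => simp
  | insert b s hb ih =>
    have hne : ∀ i ∈ s, b ≠ i := fun i hi h => hb (h ▸ hi)
    rw [Finset.prod_insert hb, Derivation.leibniz, Finset.sum_insert hb, Finset.prod_insert hb,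
      Function.update_self, Finset.prod_update_of_notMem hb, ih, smul_eq_mul, smul_eq_mul,
      Finset.mul_sum, add_comm, mul_comm]
    congr 1
    refine Finset.sum_congr rfl fun i hi => ?_
    rw [Finset.prod_insert hb, Function.update_of_ne (hne i hi)]

variable {n : Type*} [Fintype n] [DecidableEq n]

theorem derivation_det_eq_sum_det_updateCol (D : Derivation k A A) (M : Matrix n n A) :
    D M.det = ∑ j, (M.updateCol j fun i => D (M i j)).det := by
  simp_rw [Matrix.det_apply]
  rw [Finset.sum_comm, map_sum]
  refine Finset.sum_congr rfl fun σ _ => ?_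
  rw [← Finset.smul_sum, Units.smul_def, map_zsmul, derivation_prod, ← Units.smul_def]
  simp only [Matrix.updateCol_apply, Function.update_apply]
  congr! 4 with j _ i _ hij
  rw [hij]

theorem derivation_det (D : Derivation k A A) (M : Matrix n n A) :
    D M.det = ∑ i, ∑ j, M.adjugate j i * D (M i j) := by
  rw [derivation_det_eq_sum_det_updateCol, Finset.sum_comm]
  refine Finset.sum_congr rfl fun j _ => ?_
  rw [← Matrix.cramer_apply, Matrix.cramer_eq_adjugate_mulVec]
  rfl

theorem derivation_aeval {τ : Type*} [Fintype τ] (D : Derivation k A A) (F : τ → A)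
    (P : MvPolynomial τ k) :
    D (aeval F P) = ∑ i, aeval F (pderiv i P) * D (F i) := by
  classical
  induction P using MvPolynomial.induction_on with
  | C a => simp
  | add p q hp hq => simp only [map_add, hp, hq, add_mul, Finset.sum_add_distrib]
  | mul_X p i hp =>
    simp only [map_mul, aeval_X, Derivation.leibniz, smul_eq_mul, hp, map_add, add_mul,
      Finset.sum_add_distrib, Finset.mul_sum, mul_assoc]
    simp [pderiv_X, Pi.single_apply]

end Derivation

/-! ### Mutually inverse tuples of forms -/

section InverseForms

theorem isHomogeneous_of_mul_X {R σ : Type*} [CommSemiring R] {p : MvPolynomial σ R} {i : σ}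
    {n : ℕ} (hp : (p * X i).IsHomogeneous (n + 1)) : p.IsHomogeneous n := by
  intro d hd
  have h := hp (d := d + Finsupp.single i 1) (by rwa [coeff_mul_X])
  simpa [Finsupp.weight_single] using h

theorem aeval_mul_X_of_isHomogeneous {R σ : Type*} [CommSemiring R] {P : MvPolynomial σ R} {n : ℕ}
    (hP : P.IsHomogeneous n) (h : MvPolynomial σ R) :
    aeval (fun i => h * X i) P = h ^ n * P := by
  have hterm : ∀ d ∈ P.support, aeval (fun i => h * X i) (monomial d (coeff d P))
      = h ^ n * monomial d (coeff d P) := by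
    intro d hd
    have hdeg : d.degree = n := by
      rw [Finsupp.degree_eq_weight_one]; exact hP (mem_support_iff.mp hd)
    rw [aeval_monomial, monomial_eq, algebraMap_eq, Finsupp.prod, Finsupp.prod]
    simp_rw [mul_pow]
    rw [Finset.prod_mul_distrib, Finset.prod_pow_eq_pow_sum, ← hdeg, Finsupp.degree_apply]
    ring
  conv_lhs => rw [P.as_sum]
  rw [map_sum, Finset.sum_congr rfl hterm, ← Finset.mul_sum, ← P.as_sum]

variable {k σ : Type*} [Field k]

theorem algebraicIndependent_mul_X {h : MvPolynomial σ k} {e : ℕ} (h0 : h ≠ 0)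
    (he : h.IsHomogeneous e) : AlgebraicIndependent k fun i => h * X i := by
  rw [algebraicIndependent_iff]
  intro P hP
  have hsum : ∑ n ∈ Finset.range (P.totalDegree + 1), h ^ n * homogeneousComponent n P = 0 := by
    rw [← hP]
    conv_rhs => rw [← P.sum_homogeneousComponent]
    rw [map_sum]
    exact Finset.sum_congr rfl fun n _ =>
      (aeval_mul_X_of_isHomogeneous (homogeneousComponent_isHomogeneous n P) h).symm
  have hdeg : ∀ n, (h ^ n * homogeneousComponent n P).IsHomogeneous ((e + 1) * n) := by
    intro n
    rw [add_one_mul]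
    exact (he.pow n).mul (homogeneousComponent_isHomogeneous n P)
  rw [← P.sum_homogeneousComponent]
  refine Finset.sum_eq_zero fun n hn => ?_
  have hn0 := congrArg (homogeneousComponent ((e + 1) * n)) hsum
  rw [map_sum, Finset.sum_eq_single_of_mem n hn, homogeneousComponent_of_mem (hdeg n), if_pos rfl,
    map_zero] at hn0
  · exact (mul_eq_zero.mp hn0).resolve_left (pow_ne_zero n h0)
  · intro l _ hl
    rw [homogeneousComponent_of_mem (hdeg l), if_neg]
    exact fun hle => hl (Nat.eq_of_mul_eq_mul_left e.succ_pos hle).symm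

variable {F G : σ → MvPolynomial σ k} {h h' : MvPolynomial σ k} {d d' : ℕ}

theorem isHomogeneous_of_aeval_eq_mul_X [Nonempty σ] (hF : ∀ i, (F i).IsHomogeneous d)
    (hG : ∀ i, (G i).IsHomogeneous d') (hGF : ∀ i, aeval F (G i) = h * X i) (hd : 1 ≤ d)
    (hd' : 1 ≤ d') : h.IsHomogeneous (d * d' - 1) := by
  obtain ⟨i⟩ := ‹Nonempty σ›
  refine isHomogeneous_of_mul_X (i := i) ?_
  rw [Nat.sub_add_cancel (Nat.mul_pos hd hd'), ← hGF]
  exact (hG i).aeval F hF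

theorem algebraicIndependent_of_aeval_eq_mul_X {e : ℕ} (h0 : h' ≠ 0) (he : h'.IsHomogeneous e)
    (hFG : ∀ i, aeval G (F i) = h' * X i) : AlgebraicIndependent k F := by
  rw [algebraicIndependent_iff]
  intro P hP
  refine algebraicIndependent_iff.mp (algebraicIndependent_mul_X h0 he) P ?_
  rw [← funext hFG, ← comp_aeval_apply, hP, map_zero]

theorem ne_zero_of_aeval_eq_mul_X [Nonempty σ] (hF : ∀ i, (F i).IsHomogeneous d)
    (hG : ∀ i, (G i).IsHomogeneous d') (h0 : h ≠ 0) (hGF : ∀ i, aeval F (G i) = h * X i)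
    (hFG : ∀ i, aeval G (F i) = h' * X i) (hd : 1 ≤ d) (hd' : 1 ≤ d') : h' ≠ 0 := by
  rintro rfl
  have hF0 : F = 0 := by
    funext i
    refine algebraicIndependent_iff.mp
      (algebraicIndependent_mul_X h0 (isHomogeneous_of_aeval_eq_mul_X hF hG hGF hd hd')) (F i) ?_
    rw [← funext hGF, ← comp_aeval_apply, hFG, zero_mul, map_zero]
  obtain ⟨i⟩ := ‹Nonempty σ›
  refine mul_ne_zero h0 (X_ne_zero i) ?_
  rw [← hGF, hF0, aeval_zero, constantCoeff_eq, (hG i).coeff_eq_zero (by simp; omega), map_zero]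

theorem isCremona_of_aeval_eq_mul_X [Nonempty σ] (hF : ∀ i, (F i).IsHomogeneous d)
    (hG : ∀ i, (G i).IsHomogeneous d') (h0 : h ≠ 0) (hGF : ∀ i, aeval F (G i) = h * X i)
    (hFG : ∀ i, aeval G (F i) = h' * X i) (hd : 1 ≤ d) (hd' : 1 ≤ d') : IsCremona F := by
  have h0' := ne_zero_of_aeval_eq_mul_X hF hG h0 hGF hFG hd hd'
  have hFind : AlgebraicIndependent k F :=
    algebraicIndependent_of_aeval_eq_mul_X h0'
      (isHomogeneous_of_aeval_eq_mul_X hG hF hFG hd' hd) hFG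
  have hGind : AlgebraicIndependent k G :=
    algebraicIndependent_of_aeval_eq_mul_X h0 (isHomogeneous_of_aeval_eq_mul_X hF hG hGF hd hd') hGF
  obtain ⟨i⟩ := ‹Nonempty σ›
  refine ⟨⟨⟨d, hd, hF, i, hFind.ne_zero i⟩, G, ⟨d', hd', hG, i, hGind.ne_zero i⟩, ⟨i, ?_⟩,
    fun i j => ?_⟩, algebraicIndependent_iff_ker_eq_bot.mp hFind⟩
  · rw [imageIdeal, RingHom.mem_ker, hGF]
    exact mul_ne_zero h0 (X_ne_zero i)
  · rw [hGF, hGF]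
    ring

/-- The Jacobian matrix of a tuple of polynomials, with one row for each polynomial. -/
noncomputable def jacobian (F : σ → MvPolynomial σ k) : Matrix σ σ (MvPolynomial σ k) :=
  Matrix.of fun i j => pderiv j (F i)

variable [Fintype σ]

theorem jacobian_aeval (F G : σ → MvPolynomial σ k) :
    jacobian (fun i => aeval F (G i)) = (jacobian G).map (aeval F) * jacobian F := by
  ext1 i j
  simp only [jacobian, Matrix.of_apply, Matrix.mul_apply, Matrix.map_apply, derivation_aeval]

variable [DecidableEq σ]

theorem jacobian_mul_X (h : MvPolynomial σ k) :
    jacobian (fun i => h * X i)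
      = Matrix.scalar σ h - Matrix.vecMulVec (fun i => -X i) fun j => pderiv j h := by
  ext1 i j
  simp [jacobian, Matrix.vecMulVec_apply, Matrix.diagonal_apply, pderiv_X, Pi.single_apply]

theorem det_jacobian_mul_X [Nonempty σ] {e : ℕ} (he : h.IsHomogeneous e) :
    (jacobian fun i => h * X i).det = ((e + 1 : ℕ) : MvPolynomial σ k) * h ^ Fintype.card σ := by
  have hEuler : (fun i => -X i) ⬝ᵥ (fun i => pderiv i h) = -(e * h) := by
    simp only [dotProduct, neg_mul, Finset.sum_neg_distrib, he.sum_X_mul_pderiv, nsmul_eq_mul]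
  rw [jacobian_mul_X, ← Matrix.eval_charpoly, Matrix.charpoly_vecMulVec, hEuler]
  obtain ⟨c, hc⟩ := Nat.exists_eq_add_one.mpr (Fintype.card_pos (α := σ))
  simp only [Polynomial.eval_sub, Polynomial.eval_pow, Polynomial.eval_X, Polynomial.eval_smul,
    smul_eq_mul, hc, Nat.add_sub_cancel]
  push_cast
  ring

theorem det_jacobian_ne_zero_of_aeval_eq_mul_X [Nonempty σ] (hF : ∀ i, (F i).IsHomogeneous d)
    (hG : ∀ i, (G i).IsHomogeneous d') (h0 : h ≠ 0) (hGF : ∀ i, aeval F (G i) = h * X i)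
    (hk : ((d * d' : ℕ) : k) ≠ 0) : (jacobian F).det ≠ 0 := by
  intro hdet
  have hpos : 0 < d * d' := Nat.pos_of_ne_zero fun hz => hk (by rw [hz, Nat.cast_zero])
  have he := isHomogeneous_of_aeval_eq_mul_X hF hG hGF (Nat.pos_of_mul_pos_right hpos)
    (Nat.pos_of_mul_pos_left hpos)
  have hcomp := congrArg Matrix.det (jacobian_aeval F G)
  simp only [hGF] at hcomp
  rw [det_jacobian_mul_X he, Matrix.det_mul, hdet, mul_zero, Nat.sub_add_cancel hpos,
    ← map_natCast (C : k →+* MvPolynomial σ k)] at hcomp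
  exact mul_ne_zero (C_ne_zero.mpr hk) (pow_ne_zero _ h0) hcomp

end InverseForms

/-! ### Balancing two principal cofactors of a matrix -/

section Balance

open scoped Matrix

variable {A n : Type*} [CommRing A] [Fintype n] [DecidableEq n]

/-- The matrix of cofactors of `M`: its `(i, j)` entry is the signed minor at `(i, j)`. -/
def cofactorMatrix (M : Matrix n n A) : Matrix n n A := M.adjugateᵀ

theorem cofactorMatrix_cofactorMatrix [Nontrivial n] (M : Matrix n n A) :
    cofactorMatrix (cofactorMatrix M) = M.det ^ (Fintype.card n - 2) • M := by
  rw [cofactorMatrix, cofactorMatrix, ← Matrix.adjugate_transpose, Matrix.transpose_transpose,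
    Matrix.adjugate_adjugate']

theorem cofactorMatrix_smul (c : A) (M : Matrix n n A) :
    cofactorMatrix (c • M) = c ^ (Fintype.card n - 1) • cofactorMatrix M := by
  rw [cofactorMatrix, Matrix.adjugate_smul, Matrix.transpose_smul, cofactorMatrix]

theorem cofactorMatrix_one : cofactorMatrix (1 : Matrix n n A) = 1 := by
  rw [cofactorMatrix, Matrix.adjugate_one, Matrix.transpose_one]

theorem map_cofactorMatrix {B : Type*} [CommRing B] (φ : A →+* B) (M : Matrix n n A) :
    (cofactorMatrix M).map φ = cofactorMatrix (M.map φ) := by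
  rw [cofactorMatrix, Matrix.transpose_map, cofactorMatrix]
  exact congrArg _ (φ.map_adjugate M)

/-- The minor of `Y` obtained by deleting the rows and the columns `s` and `l`. -/
def doubleMinor (s l : n) (Y : Matrix n n A) : A :=
  (Y.toSquareBlockProp fun i => ¬(i = s ∨ i = l)).det

theorem det_updateRow_updateRow_single {s l : n} (hsl : s ≠ l) (Y : Matrix n n A) :
    ((Y.updateRow s (Pi.single s 1)).updateRow l (Pi.single l 1)).det = doubleMinor s l Y := by
  rw [Matrix.twoBlockTriangular_det' _ fun i => i = s ∨ i = l]
  · have hone : Matrix.toSquareBlockProp ((Y.updateRow s (Pi.single s 1)).updateRow l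
        (Pi.single l 1)) (fun i => i = s ∨ i = l) = 1 := by
      ext ⟨i, hi⟩ ⟨j, hj⟩
      rcases hi with rfl | rfl <;> rcases hj with rfl | rfl <;>
        simp [Matrix.toSquareBlockProp_def, Matrix.updateRow_apply, hsl, hsl.symm]
    rw [hone, Matrix.det_one, one_mul, doubleMinor]
    congr 1
    ext ⟨i, hi⟩ ⟨j, hj⟩
    rw [not_or] at hi
    simp [Matrix.toSquareBlockProp_def, Matrix.updateRow_apply, hi]
  · rintro i hi j hj
    rw [not_or] at hj
    rcases hi with rfl | rfl <;> simp [Matrix.updateRow_apply, hsl, hj]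

theorem doubleMinor_comm (s l : n) (Y : Matrix n n A) :
    doubleMinor s l Y = doubleMinor l s Y := by
  rw [doubleMinor, doubleMinor]
  congr! 2 <;> simp only [or_comm]

theorem doubleMinor_one (s l : n) : doubleMinor s l (1 : Matrix n n A) = 1 := by
  rw [doubleMinor, ← Matrix.det_one (n := {i : n // ¬(i = s ∨ i = l)})]
  congr 1
  ext i j
  simp [Matrix.toSquareBlockProp_def, Matrix.one_apply, Subtype.ext_iff]

theorem map_doubleMinor {B : Type*} [CommRing B] (φ : A →+* B) (s l : n) (Y : Matrix n n A) :
    φ (doubleMinor s l Y) = doubleMinor s l (Y.map φ) :=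
  φ.map_det _

theorem card_compl_pair {s l : n} (hsl : s ≠ l) :
    Fintype.card {i : n // ¬(i = s ∨ i = l)} = Fintype.card n - 2 := by
  rw [Fintype.card_subtype_compl, ← Finset.card_pair hsl]
  simp [Fintype.card_subtype, Finset.filter_or, Finset.filter_eq']

theorem doubleMinor_smul {s l : n} (hsl : s ≠ l) (c : A) (Y : Matrix n n A) :
    doubleMinor s l (c • Y) = c ^ (Fintype.card n - 2) * doubleMinor s l Y := by
  rw [← card_compl_pair hsl]
  exact Matrix.det_smul _ c

/-- The diagonal matrix with entry `1` at `s`, entry `-1` at `l` and zeros elsewhere. -/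
def diagonalDifference (A : Type*) [CommRing A] (s l : n) : Matrix n n A :=
  Matrix.single s s 1 - Matrix.single l l 1

theorem doubleMinor_add_smul_diagonalDifference (s l : n) (Y : Matrix n n A) (t : A) :
    doubleMinor s l (Y + t • diagonalDifference A s l) = doubleMinor s l Y := by
  rw [doubleMinor, doubleMinor]
  congr 1
  ext ⟨i, hi⟩ ⟨j, hj⟩
  rw [not_or] at hi
  simp [Matrix.toSquareBlockProp_def, diagonalDifference, Matrix.single_apply, Ne.symm hi.1,
    Ne.symm hi.2]

theorem cofactorMatrix_add_smul_diagonalDifference_left {s l : n} (hsl : s ≠ l)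
    (Y : Matrix n n A) (t : A) :
    cofactorMatrix (Y + t • diagonalDifference A s l) s s
      = cofactorMatrix Y s s - t * doubleMinor s l Y := by
  have hrow : (Y + t • diagonalDifference A s l).updateRow s (Pi.single s 1)
      = (Y.updateRow s (Pi.single s 1)).updateRow l (Y l + -t • Pi.single l 1) := by
    ext i j
    by_cases hi : i = l
    · subst hi
      simp [hsl, hsl.symm, diagonalDifference, Matrix.single_apply, Pi.single_apply, eq_comm]
    · by_cases his : i = s
      · simp [his, hsl]
      · simp [hi, his, Ne.symm hi, Ne.symm his, diagonalDifference]
  have hself : (Y.updateRow s (Pi.single s 1)).updateRow l (Y l)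
      = Y.updateRow s (Pi.single s 1) := by
    conv_rhs => rw [← Matrix.updateRow_eq_self (Y.updateRow s (Pi.single s 1)) l]
    rw [Matrix.updateRow_ne hsl.symm]
  simp only [cofactorMatrix, Matrix.transpose_apply, Matrix.adjugate_apply]
  rw [hrow, Matrix.det_updateRow_add, Matrix.det_updateRow_smul, hself,
    det_updateRow_updateRow_single hsl, neg_mul, sub_eq_add_neg]

theorem cofactorMatrix_add_smul_diagonalDifference_right {s l : n} (hsl : s ≠ l)
    (Y : Matrix n n A) (t : A) :
    cofactorMatrix (Y + t • diagonalDifference A s l) l l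
      = cofactorMatrix Y l l + t * doubleMinor s l Y := by
  have hneg : diagonalDifference A s l = -diagonalDifference A l s := (neg_sub _ _).symm
  rw [hneg, smul_neg, ← neg_smul,
    cofactorMatrix_add_smul_diagonalDifference_left hsl.symm, neg_mul, sub_neg_eq_add,
    doubleMinor_comm]

/-- A multiple of `Y`, shifted along the matrix unit difference `E s s - E l l` so that the two
cofactors at `(s, s)` and `(l, l)` become equal; the factor in front of `Y` avoids denominators. -/
def balance (s l : n) (Y : Matrix n n A) : Matrix n n A :=
  (2 * doubleMinor s l Y) • Y
    + (cofactorMatrix Y s s - cofactorMatrix Y l l) • diagonalDifference A s l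

theorem cofactorMatrix_balance_left_eq_right {s l : n} (hsl : s ≠ l) (Y : Matrix n n A) :
    cofactorMatrix (balance s l Y) s s = cofactorMatrix (balance s l Y) l l := by
  have : Nontrivial n := ⟨s, l, hsl⟩
  obtain ⟨c, hc⟩ := Nat.exists_eq_add_of_le' (Fintype.one_lt_card (α := n))
  rw [balance, cofactorMatrix_add_smul_diagonalDifference_left hsl,
    cofactorMatrix_add_smul_diagonalDifference_right hsl, cofactorMatrix_smul,
    doubleMinor_smul hsl, Matrix.smul_apply, Matrix.smul_apply, hc]
  simp only [smul_eq_mul, Nat.add_sub_cancel, show c + 1 + 1 - 1 = c + 1 from rfl]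
  ring

theorem balance_add_smul_diagonalDifference {s l : n} (hsl : s ≠ l) (Y : Matrix n n A) (t : A) :
    balance s l (Y + t • diagonalDifference A s l) = balance s l Y := by
  rw [balance, balance, doubleMinor_add_smul_diagonalDifference,
    cofactorMatrix_add_smul_diagonalDifference_left hsl,
    cofactorMatrix_add_smul_diagonalDifference_right hsl]
  module

theorem balance_of_cofactorMatrix_eq {s l : n} {Y : Matrix n n A}
    (hY : cofactorMatrix Y s s = cofactorMatrix Y l l) :
    balance s l Y = (2 * doubleMinor s l Y) • Y := by
  rw [balance, hY, sub_self, zero_smul, add_zero]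

theorem map_balance {B : Type*} [CommRing B] (φ : A →+* B) (s l : n) (Y : Matrix n n A) :
    (balance s l Y).map φ = balance s l (Y.map φ) := by
  ext i j
  simp only [balance, ← map_cofactorMatrix, ← map_doubleMinor, Matrix.map_apply, Matrix.add_apply,
    Matrix.smul_apply, smul_eq_mul, map_add, map_mul, map_sub, map_ofNat, diagonalDifference,
    Matrix.sub_apply, Matrix.single_apply]
  simp only [apply_ite φ, map_one, map_zero]

end Balance

/-! ### The cloned matrix and its polar map -/

section CloneFill

variable {A B : Type*} {m : ℕ} (hm : 2 ≤ m)

/-- The last row and column, whose diagonal slot receives the cloned entry. -/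
def targetIndex : Fin m := ⟨m - 1, by omega⟩

/-- The last but one row and column, whose diagonal entry is cloned. -/
def sourceIndex : Fin m := ⟨m - 2, by omega⟩

theorem sourceIndex_ne_targetIndex : sourceIndex hm ≠ targetIndex hm := by
  simp only [sourceIndex, targetIndex, ne_eq, Fin.mk.injEq]
  omega

theorem eq_targetIndex_iff (i : Fin m) : i = targetIndex hm ↔ i.val + 1 = m := by
  rw [Fin.ext_iff, show (targetIndex hm).val = m - 1 from rfl]
  omega

theorem cloneSource_eq : (cloneSource m hm).1 = (sourceIndex hm, sourceIndex hm) := rfl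

/-- The variable at position `(i, j)` of the cloned matrix. -/
def cloneIndex (i j : Fin m) : CloneVar m :=
  if h : i.val + 1 = m ∧ j.val + 1 = m then cloneSource m hm else ⟨(i, j), h⟩

theorem cloneIndex_target : cloneIndex hm (targetIndex hm) (targetIndex hm) = cloneSource m hm :=
  dif_pos ⟨(eq_targetIndex_iff hm _).mp rfl, (eq_targetIndex_iff hm _).mp rfl⟩

theorem cloneIndex_cloneVar (p : CloneVar m) : cloneIndex hm p.1.1 p.1.2 = p := dif_neg p.2

theorem forall_iff_forall_cloneVar_and_target {P : Fin m → Fin m → Prop} :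
    (∀ i j, P i j) ↔
      (∀ p : CloneVar m, P p.1.1 p.1.2) ∧ P (targetIndex hm) (targetIndex hm) := by
  refine ⟨fun h => ⟨fun p => h _ _, h _ _⟩, fun h i j => ?_⟩
  by_cases hij : i.val + 1 = m ∧ j.val + 1 = m
  · rw [(eq_targetIndex_iff hm i).mpr hij.1, (eq_targetIndex_iff hm j).mpr hij.2]
    exact h.2
  · exact h.1 ⟨(i, j), hij⟩

/-- The matrix with the entries `v`, the target slot being a clone of the source slot. -/
def cloneFill (v : CloneVar m → A) : Matrix (Fin m) (Fin m) A :=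
  Matrix.of fun i j => v (cloneIndex hm i j)

/-- The entries of a matrix outside the target slot. -/
def restrict (N : Matrix (Fin m) (Fin m) A) (p : CloneVar m) : A := N p.1.1 p.1.2

theorem restrict_cloneFill (v : CloneVar m → A) : restrict (cloneFill hm v) = v :=
  funext fun p => congrArg v (cloneIndex_cloneVar hm p)

theorem cloneFill_source_eq_target (v : CloneVar m → A) :
    cloneFill hm v (sourceIndex hm) (sourceIndex hm)
      = cloneFill hm v (targetIndex hm) (targetIndex hm) := by
  rw [cloneFill, Matrix.of_apply, Matrix.of_apply, cloneIndex_target]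
  exact congrArg v (cloneIndex_cloneVar hm (cloneSource m hm))

theorem cloneFill_restrict {N : Matrix (Fin m) (Fin m) A}
    (hN : N (sourceIndex hm) (sourceIndex hm) = N (targetIndex hm) (targetIndex hm)) :
    cloneFill hm (restrict N) = N := by
  rw [← Matrix.ext_iff, forall_iff_forall_cloneVar_and_target hm]
  refine ⟨fun p => congrFun (restrict_cloneFill hm (restrict N)) p, ?_⟩
  rw [← cloneFill_source_eq_target, ← hN]
  exact congrFun (restrict_cloneFill hm (restrict N)) (cloneSource m hm)

variable [CommRing A] [CommRing B]

variable (k : Type*) [Field k] in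
theorem clonedMatrix_eq_cloneFill : clonedMatrix k m hm = cloneFill hm X := by
  ext i j : 2
  simp only [clonedMatrix, cloneFill, cloneIndex, Matrix.of_apply, apply_dite X]

theorem map_cloneFill (φ : A →+* B) (v : CloneVar m → A) :
    (cloneFill hm v).map φ = cloneFill hm fun p => φ (v p) := rfl

theorem sum_eq_sum_cloneVar_add (f : Fin m → Fin m → A) :
    ∑ i, ∑ j, f i j = ∑ p : CloneVar m, f p.1.1 p.1.2 + f (targetIndex hm) (targetIndex hm) := by
  rw [← Fintype.sum_prod_type', ← Finset.sum_erase_add _ _ (Finset.mem_univ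
    (targetIndex hm, targetIndex hm))]
  congr 1
  refine Finset.sum_subtype _ (fun q => ?_) _
  simp [Prod.ext_iff, eq_targetIndex_iff hm]

/-- The matrix with the entries `v` and a zero in the target slot. -/
def zeroFill (v : CloneVar m → A) : Matrix (Fin m) (Fin m) A :=
  Matrix.of fun i j => if h : i.val + 1 = m ∧ j.val + 1 = m then 0 else v ⟨(i, j), h⟩

theorem map_zeroFill (φ : A →+* B) (v : CloneVar m → A) :
    (zeroFill v).map φ = zeroFill fun p => φ (v p) := by
  ext i j
  simp only [zeroFill, Matrix.map_apply, Matrix.of_apply, apply_dite φ, map_zero]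

theorem zeroFill_cloneVar (v : CloneVar m → A) (p : CloneVar m) :
    zeroFill v p.1.1 p.1.2 = v p := dif_neg p.2

theorem zeroFill_target (v : CloneVar m → A) :
    zeroFill v (targetIndex hm) (targetIndex hm) = 0 :=
  dif_pos ⟨(eq_targetIndex_iff hm _).mp rfl, (eq_targetIndex_iff hm _).mp rfl⟩

/-- The transpose of `cloneFill`: the entry in the target slot is added to the one in the source
slot. -/
def fold (N : Matrix (Fin m) (Fin m) A) (p : CloneVar m) : A :=
  N p.1.1 p.1.2 + if p = cloneSource m hm then N (targetIndex hm) (targetIndex hm) else 0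

theorem restrict_smul (c : A) (N : Matrix (Fin m) (Fin m) A) :
    restrict (c • N) = c • restrict N := rfl

theorem fold_smul (c : A) (N : Matrix (Fin m) (Fin m) A) : fold hm (c • N) = c • fold hm N := by
  funext p
  simp only [fold, Matrix.smul_apply, Pi.smul_apply, smul_add, smul_ite, smul_zero]

theorem fold_add (M N : Matrix (Fin m) (Fin m) A) : fold hm (M + N) = fold hm M + fold hm N := by
  funext p
  simp only [fold, Matrix.add_apply, Pi.add_apply]
  split_ifs <;> ring

theorem diagonalDifference_cloneVar (p : CloneVar m) :
    diagonalDifference A (sourceIndex hm) (targetIndex hm) p.1.1 p.1.2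
      = if p = cloneSource m hm then 1 else 0 := by
  have hp : ¬(targetIndex hm = p.1.1 ∧ targetIndex hm = p.1.2) := fun h =>
    p.2 ⟨(eq_targetIndex_iff hm _).mp h.1.symm, (eq_targetIndex_iff hm _).mp h.2.symm⟩
  rw [diagonalDifference, Matrix.sub_apply, Matrix.single_apply, Matrix.single_apply, if_neg hp,
    sub_zero]
  simp only [Subtype.ext_iff, Prod.ext_iff, cloneSource_eq, eq_comm]

theorem diagonalDifference_target :
    diagonalDifference A (sourceIndex hm) (targetIndex hm) (targetIndex hm) (targetIndex hm)
      = -1 := by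
  simp [diagonalDifference, sourceIndex_ne_targetIndex hm]

theorem fold_diagonalDifference :
    fold hm (diagonalDifference A (sourceIndex hm) (targetIndex hm)) = 0 := by
  funext p
  rw [fold, diagonalDifference_cloneVar, diagonalDifference_target]
  split_ifs <;> simp

theorem fold_zeroFill (v : CloneVar m → A) : fold hm (zeroFill v) = v := by
  funext p
  rw [fold, zeroFill_target, ite_self, add_zero, zeroFill_cloneVar]

theorem zeroFill_fold (N : Matrix (Fin m) (Fin m) A) :
    zeroFill (fold hm N) = N + N (targetIndex hm) (targetIndex hm) •
      diagonalDifference A (sourceIndex hm) (targetIndex hm) := by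
  rw [← Matrix.ext_iff, forall_iff_forall_cloneVar_and_target hm]
  constructor
  · intro p
    rw [zeroFill_cloneVar, fold, Matrix.add_apply, Matrix.smul_apply, diagonalDifference_cloneVar,
      smul_eq_mul, mul_ite, mul_one, mul_zero]
  · rw [zeroFill_target, Matrix.add_apply, Matrix.smul_apply, diagonalDifference_target,
      smul_eq_mul, mul_neg_one, add_neg_cancel]

theorem sum_cloneFill_mul (v : CloneVar m → A) (N : Matrix (Fin m) (Fin m) A) :
    ∑ i, ∑ j, cloneFill hm v i j * N i j = ∑ p, v p * fold hm N p := by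
  simp only [sum_eq_sum_cloneVar_add hm, fold, mul_add, mul_ite, mul_zero, Finset.sum_add_distrib,
    Finset.sum_ite_eq', Finset.mem_univ, if_true]
  congr 1
  · exact Finset.sum_congr rfl fun p _ => by rw [cloneFill, Matrix.of_apply, cloneIndex_cloneVar]
  · rw [cloneFill, Matrix.of_apply, cloneIndex_target]

/-- The point at which the cloned matrix is the identity matrix. -/
def identityPoint (A : Type*) [CommRing A] (m : ℕ) : CloneVar m → A := restrict 1

theorem cloneFill_identityPoint : cloneFill hm (identityPoint A m) = 1 :=
  cloneFill_restrict hm (by rw [Matrix.one_apply_eq, Matrix.one_apply_eq])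

/-- The polar map of the cloned determinant, evaluated at a point `v` with coordinates in any
commutative ring. -/
def polarPoint (v : CloneVar m → A) : CloneVar m → A :=
  fold hm (cofactorMatrix (cloneFill hm v))

/-- The inverse of the polar map: the balanced matrix of a polar point is, up to the factor
`2 * doubleMinor`, the matrix of cofactors of the cloned matrix, whose cofactors are in turn
proportional to the cloned matrix. -/
def inversePolarPoint (v : CloneVar m → A) : CloneVar m → A :=
  restrict (cofactorMatrix (balance (sourceIndex hm) (targetIndex hm) (zeroFill v)))

theorem map_polarPoint (φ : A →+* B) (v : CloneVar m → A) (p : CloneVar m) :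
    φ (polarPoint hm v p) = polarPoint hm (fun q => φ (v q)) p := by
  rw [polarPoint, polarPoint, ← map_cloneFill, ← map_cofactorMatrix]
  simp only [fold, map_add, apply_ite φ, map_zero, Matrix.map_apply]

theorem map_inversePolarPoint (φ : A →+* B) (v : CloneVar m → A) (p : CloneVar m) :
    φ (inversePolarPoint hm v p) = inversePolarPoint hm (fun q => φ (v q)) p := by
  rw [inversePolarPoint, inversePolarPoint, ← map_zeroFill, ← map_balance, ← map_cofactorMatrix]
  rfl

theorem inversePolarPoint_polarPoint (v : CloneVar m → A) :
    inversePolarPoint hm (polarPoint hm v) =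
      ((2 * doubleMinor (sourceIndex hm) (targetIndex hm) (cofactorMatrix (cloneFill hm v)))
          ^ (m - 1) * (cloneFill hm v).det ^ (m - 2)) • v := by
  have : Nontrivial (Fin m) := Fin.nontrivial_iff_two_le.mpr hm
  set N := cofactorMatrix (cloneFill hm v)
  have hN : cofactorMatrix N = (cloneFill hm v).det ^ (m - 2) • cloneFill hm v := by
    rw [cofactorMatrix_cofactorMatrix, Fintype.card_fin]
  have hbalanced : cofactorMatrix N (sourceIndex hm) (sourceIndex hm)
      = cofactorMatrix N (targetIndex hm) (targetIndex hm) := by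
    rw [hN, Matrix.smul_apply, Matrix.smul_apply, cloneFill_source_eq_target]
  rw [inversePolarPoint, polarPoint, zeroFill_fold, balance_add_smul_diagonalDifference
    (sourceIndex_ne_targetIndex hm), balance_of_cofactorMatrix_eq hbalanced, cofactorMatrix_smul,
    Fintype.card_fin, hN, smul_smul, restrict_smul, restrict_cloneFill]

theorem polarPoint_inversePolarPoint (v : CloneVar m → A) :
    polarPoint hm (inversePolarPoint hm v) =
      ((balance (sourceIndex hm) (targetIndex hm) (zeroFill v)).det ^ (m - 2)
        * (2 * doubleMinor (sourceIndex hm) (targetIndex hm) (zeroFill v))) • v := by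
  have : Nontrivial (Fin m) := Fin.nontrivial_iff_two_le.mpr hm
  rw [polarPoint, inversePolarPoint, cloneFill_restrict hm
    (cofactorMatrix_balance_left_eq_right (sourceIndex_ne_targetIndex hm) _),
    cofactorMatrix_cofactorMatrix, Fintype.card_fin, fold_smul, mul_smul]
  congr 1
  rw [balance, fold_add, fold_smul, fold_smul, fold_zeroFill, fold_diagonalDifference, smul_zero,
    add_zero]

end CloneFill

/-! ### Degrees of determinantal forms -/

section Degrees

variable {R σ n : Type*} [CommRing R] [Fintype n] [DecidableEq n]

theorem isHomogeneous_det {M : Matrix n n (MvPolynomial σ R)} {d : n → ℕ}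
    (h : ∀ i j, (M i j).IsHomogeneous (d i)) : M.det.IsHomogeneous (∑ i, d i) := by
  rw [← Matrix.det_transpose, Matrix.det_apply]
  refine IsHomogeneous.sum _ _ _ fun τ _ => ?_
  rw [Units.smul_def]
  exact zsmul_mem (K := homogeneousSubmodule σ R _) (IsHomogeneous.prod _ _ _ fun i _ => h _ _) _

variable {M : Matrix n n (MvPolynomial σ R)} {d : ℕ}

theorem isHomogeneous_cofactorMatrix (h : ∀ i j, (M i j).IsHomogeneous d) (i j : n) :
    (cofactorMatrix M i j).IsHomogeneous ((Fintype.card n - 1) * d) := by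
  have hrow : ∀ a b, (M.updateRow i (Pi.single j 1) a b).IsHomogeneous
      (Function.update (fun _ => d) i 0 a) := by
    intro a b
    by_cases ha : a = i
    · rw [ha, Matrix.updateRow_self, Function.update_self, Pi.single_apply]
      split_ifs
      exacts [isHomogeneous_one _ _, isHomogeneous_zero _ _ _]
    · rw [Matrix.updateRow_ne ha, Function.update_of_ne ha]
      exact h a b
  have hdet := isHomogeneous_det hrow
  rw [Finset.sum_update_of_mem (Finset.mem_univ i), Finset.sum_const, zero_add, smul_eq_mul,
    Finset.card_sdiff_of_subset (Finset.subset_univ _), Finset.card_univ,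
    Finset.card_singleton] at hdet
  rwa [cofactorMatrix, Matrix.transpose_apply, Matrix.adjugate_apply]

theorem isHomogeneous_doubleMinor {s l : n} (hsl : s ≠ l) (h : ∀ i j, (M i j).IsHomogeneous d) :
    (doubleMinor s l M).IsHomogeneous ((Fintype.card n - 2) * d) := by
  have hdet := isHomogeneous_det (d := fun _ => d)
    (M := M.toSquareBlockProp fun i => ¬(i = s ∨ i = l)) fun i j => h i j
  rwa [Finset.sum_const, Finset.card_univ, card_compl_pair hsl] at hdet

theorem isHomogeneous_balance {s l : n} (hsl : s ≠ l) (h : ∀ i j, (M i j).IsHomogeneous d)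
    (i j : n) : (balance s l M i j).IsHomogeneous ((Fintype.card n - 1) * d) := by
  have : Nontrivial n := ⟨s, l, hsl⟩
  obtain ⟨c, hc⟩ := Nat.exists_eq_add_of_le' (Fintype.one_lt_card (α := n))
  have hminor : (2 * doubleMinor s l M * M i j).IsHomogeneous ((Fintype.card n - 1) * d) := by
    have hprod := (isHomogeneous_doubleMinor hsl h).mul (h i j)
    rw [hc, Nat.add_sub_cancel, ← add_one_mul] at hprod
    rw [hc, two_mul, add_mul]
    exact hprod.add hprod
  have hunit : (diagonalDifference (MvPolynomial σ R) s l i j).IsHomogeneous 0 := by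
    rw [diagonalDifference, Matrix.sub_apply, Matrix.single_apply, Matrix.single_apply]
    refine IsHomogeneous.sub ?_ ?_ <;> split_ifs
    exacts [isHomogeneous_one _ _, isHomogeneous_zero _ _ _, isHomogeneous_one _ _,
      isHomogeneous_zero _ _ _]
  exact hminor.add (((isHomogeneous_cofactorMatrix h s s).sub
    (isHomogeneous_cofactorMatrix h l l)).mul hunit)

end Degrees

section Homaloidal

variable (k : Type*) [Field k] {m : ℕ} (hm : 2 ≤ m)

theorem polarMap_clonedDet : polarMap (clonedDet k m hm) = polarPoint hm X := by
  classical
  funext p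
  have hcoord := sum_cloneFill_mul hm (Pi.single p (1 : MvPolynomial (CloneVar m) k))
    (cofactorMatrix (cloneFill hm X))
  simp only [Pi.single_apply, ite_mul, one_mul, zero_mul, Finset.sum_ite_eq', Finset.mem_univ,
    if_true] at hcoord
  rw [polarPoint, ← hcoord, polarMap, clonedDet, derivation_det, clonedMatrix_eq_cloneFill hm]
  refine Finset.sum_congr rfl fun i _ => Finset.sum_congr rfl fun j _ => ?_
  simp only [cloneFill, Matrix.of_apply, pderiv_X, Pi.single_apply, cofactorMatrix,
    Matrix.transpose_apply, eq_comm, ite_mul, mul_ite, one_mul, mul_one, zero_mul, mul_zero]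

theorem cloneFill_map_aeval_identityPoint :
    (cloneFill hm (X : CloneVar m → MvPolynomial (CloneVar m) k)).map
      (aeval (identityPoint k m)) = 1 := by
  rw [← cloneFill_identityPoint hm, ← AlgHom.coe_toRingHom, map_cloneFill]
  simp only [RingHom.coe_coe, aeval_X]

theorem aeval_identityPoint_clonedDet :
    aeval (identityPoint k m) (clonedDet k m hm) = 1 := by
  rw [clonedDet, clonedMatrix_eq_cloneFill, AlgHom.map_det, AlgHom.mapMatrix_apply,
    cloneFill_map_aeval_identityPoint, Matrix.det_one]

theorem isHomogeneous_cloneFill_X (i j : Fin m) :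
    (cloneFill hm (X : CloneVar m → MvPolynomial (CloneVar m) k) i j).IsHomogeneous 1 :=
  isHomogeneous_X _ _

theorem isHomogeneous_clonedDet : (clonedDet k m hm).IsHomogeneous m := by
  have hdet := isHomogeneous_det (d := fun _ => 1) (isHomogeneous_cloneFill_X k hm)
  rwa [Finset.sum_const, Finset.card_univ, Fintype.card_fin, smul_eq_mul, mul_one,
    ← clonedMatrix_eq_cloneFill] at hdet

theorem isHomogeneous_polarMap_clonedDet (p : CloneVar m) :
    (polarMap (clonedDet k m hm) p).IsHomogeneous (m - 1) :=
  (isHomogeneous_clonedDet k hm).pderiv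

/-- The inverse of the polar map of the cloned determinant, as a tuple of forms. -/
noncomputable def inversePolarMap : CloneVar m → MvPolynomial (CloneVar m) k :=
  inversePolarPoint hm X

theorem isHomogeneous_inversePolarMap (p : CloneVar m) :
    (inversePolarMap k hm p).IsHomogeneous ((m - 1) * (m - 1)) := by
  have hX : ∀ i j,
      (zeroFill (X : CloneVar m → MvPolynomial (CloneVar m) k) i j).IsHomogeneous 1 := by
    rw [forall_iff_forall_cloneVar_and_target hm]
    refine ⟨fun q => ?_, ?_⟩
    · rw [zeroFill_cloneVar]
      exact isHomogeneous_X _ _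
    · rw [zeroFill_target]
      exact isHomogeneous_zero _ _ _
  have hB := isHomogeneous_cofactorMatrix
    (isHomogeneous_balance (sourceIndex_ne_targetIndex hm) hX) p.1.1 p.1.2
  rwa [Fintype.card_fin, mul_one] at hB

/-- The common factor of the coordinates of the inverse polar map composed with the polar map. -/
noncomputable def inverseFactor : MvPolynomial (CloneVar m) k :=
  (2 * doubleMinor (sourceIndex hm) (targetIndex hm) (cofactorMatrix (clonedMatrix k m hm)))
      ^ (m - 1) * clonedDet k m hm ^ (m - 2)

theorem aeval_polarMap_inversePolarMap (p : CloneVar m) :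
    aeval (polarMap (clonedDet k m hm)) (inversePolarMap k hm p) = inverseFactor k hm * X p := by
  rw [inversePolarMap, ← AlgHom.coe_toRingHom, map_inversePolarPoint]
  simp only [RingHom.coe_coe, aeval_X, polarMap_clonedDet]
  rw [inversePolarPoint_polarPoint, inverseFactor, clonedDet, clonedMatrix_eq_cloneFill]
  rfl

theorem aeval_inversePolarMap_polarMap (p : CloneVar m) :
    aeval (inversePolarMap k hm) (polarMap (clonedDet k m hm) p) =
      (balance (sourceIndex hm) (targetIndex hm) (zeroFill X)).det ^ (m - 2)
        * (2 * doubleMinor (sourceIndex hm) (targetIndex hm) (zeroFill X)) * X p := by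
  rw [polarMap_clonedDet, ← AlgHom.coe_toRingHom, map_polarPoint]
  simp only [RingHom.coe_coe, aeval_X, inversePolarMap]
  rw [polarPoint_inversePolarPoint]
  rfl

variable {k}

theorem inverseFactor_ne_zero (h2 : (2 : k) ≠ 0) : inverseFactor k hm ≠ 0 := by
  intro hzero
  have heval := congrArg (aeval (identityPoint k m)) hzero
  rw [inverseFactor, map_mul, map_pow, map_pow, map_mul, aeval_identityPoint_clonedDet,
    ← AlgHom.coe_toRingHom, map_doubleMinor, map_cofactorMatrix, clonedMatrix_eq_cloneFill,
    AlgHom.coe_toRingHom, cloneFill_map_aeval_identityPoint, cofactorMatrix_one,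
    doubleMinor_one, map_zero] at heval
  simp [h2] at heval

theorem isHomaloidal_clonedDet (h2 : (2 : k) ≠ 0) : IsHomaloidal (clonedDet k m hm) := by
  have : Nonempty (CloneVar m) := ⟨cloneSource m hm⟩
  have hdeg : 1 ≤ m - 1 := Nat.le_sub_one_of_lt hm
  exact ⟨⟨m, hm, isHomogeneous_clonedDet k hm⟩,
    isCremona_of_aeval_eq_mul_X (isHomogeneous_polarMap_clonedDet k hm)
      (isHomogeneous_inversePolarMap k hm) (inverseFactor_ne_zero hm h2)
      (aeval_polarMap_inversePolarMap k hm)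
      (aeval_inversePolarMap_polarMap k hm) hdeg (Nat.mul_pos hdeg hdeg)⟩

theorem hessian_eq_transpose_jacobian {σ : Type*} (f : MvPolynomial σ k) :
    hessian f = (jacobian (polarMap f)).transpose := rfl

theorem det_hessian_clonedDet_ne_zero (h2 : (2 : k) ≠ 0) (hm1 : ((m - 1 : ℕ) : k) ≠ 0) :
    (hessian (clonedDet k m hm)).det ≠ 0 := by
  have : Nonempty (CloneVar m) := ⟨cloneSource m hm⟩
  rw [hessian_eq_transpose_jacobian, Matrix.det_transpose]
  refine det_jacobian_ne_zero_of_aeval_eq_mul_X (isHomogeneous_polarMap_clonedDet k hm)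
    (isHomogeneous_inversePolarMap k hm) (inverseFactor_ne_zero hm h2)
    (aeval_polarMap_inversePolarMap k hm) ?_
  push_cast
  exact mul_ne_zero hm1 (mul_ne_zero hm1 hm1)

theorem linearIndependent_polarMap_clonedDet (h2 : (2 : k) ≠ 0) :
    LinearIndependent k (polarMap (clonedDet k m hm)) :=
  (algebraicIndependent_iff_ker_eq_bot.mpr (isHomaloidal_clonedDet hm h2).2.2).linearIndependent

end Homaloidal

/-! ### Irreducibility -/

section Irreducible

variable {R σ n : Type*} [CommRing R]

theorem notMem_vars_det [Fintype n] [DecidableEq n] {x : σ} {M : Matrix n n (MvPolynomial σ R)}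
    (hM : ∀ i j, x ∉ (M i j).vars) : x ∉ M.det.vars := by
  have hsupported : M.det ∈ supported R {x}ᶜ := by
    rw [Matrix.det_apply]
    refine sum_mem fun π _ => ?_
    rw [Units.smul_def]
    refine zsmul_mem (prod_mem fun i _ => ?_) _
    rw [mem_supported, Set.subset_compl_singleton_iff]
    exact hM _ _
  rwa [mem_supported, Set.subset_compl_singleton_iff] at hsupported

theorem det_eq_adjugate_mul_add [Fintype n] [DecidableEq n] (M : Matrix n n R) (i j : n) :
    M.det = M.adjugate j i * M i j + (M.updateRow i (Function.update (M i) j 0)).det := by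
  have hrow : M i = M i j • Pi.single j 1 + Function.update (M i) j 0 := by
    funext l
    rcases eq_or_ne l j with rfl | hl
    · simp
    · simp [hl]
  conv_lhs => rw [← Matrix.updateRow_eq_self M i, hrow]
  rw [Matrix.det_updateRow_add, Matrix.det_updateRow_smul, Matrix.adjugate_apply, mul_comm]

/-- The determinant is linear in an entry which is a variable occurring nowhere else. -/
theorem irreducible_det_of_entry_eq_X [IsDomain R] [Fintype n] [DecidableEq n]
    {M : Matrix n n (MvPolynomial σ R)} {i j : n} {x : σ} (hX : M i j = X x)
    (hvars : ∀ i' j', x ∈ (M i' j').vars → i' = i ∧ j' = j)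
    (hirr : Irreducible (M.adjugate j i)) (hdvd : ¬M.adjugate j i ∣ M.det) :
    Irreducible M.det := by
  set rest := (M.updateRow i (Function.update (M i) j 0)).det with hrest
  have hdet : M.det = M.adjugate j i * X x + rest := by rw [det_eq_adjugate_mul_add M i j, hX]
  rw [hdet] at hdvd ⊢
  refine irreducible_mul_X_add _ _ _ hirr.ne_zero ?_ ?_ ?_
  · rw [Matrix.adjugate_apply]
    refine notMem_vars_det fun i' j' hx => ?_
    rcases eq_or_ne i' i with rfl | hi
    · rw [Matrix.updateRow_self, Pi.single_apply] at hx
      split_ifs at hx <;> simp at hx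
    · rw [Matrix.updateRow_ne hi] at hx
      exact hi (hvars i' j' hx).1
  · refine notMem_vars_det fun i' j' hx => ?_
    rcases eq_or_ne i' i with rfl | hi
    · rw [Matrix.updateRow_self] at hx
      rcases eq_or_ne j' j with rfl | hj
      · simp at hx
      · rw [Function.update_of_ne hj] at hx
        exact hj (hvars i' j' hx).2
    · rw [Matrix.updateRow_ne hi] at hx
      exact hi (hvars i' j' hx).1
  · rw [hirr.isRelPrime_iff_not_dvd]
    exact fun h => hdvd (dvd_add (dvd_mul_right _ _) h)

theorem adjugate_last_zero {n : ℕ} (M : Matrix (Fin (n + 2)) (Fin (n + 2)) R) :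
    M.adjugate (Fin.last _) 0 = (-1) ^ (n + 1) * (M.submatrix Fin.succ Fin.castSucc).det := by
  rw [Matrix.adjugate_fin_succ_eq_det_submatrix, Fin.succAbove_zero, Fin.succAbove_last]
  simp

theorem irreducible_det_of_corner [IsDomain R] {n : ℕ} (e : Fin (n + 2) → Fin (n + 2) → σ)
    (he : ∀ i j, e i j = e 0 (Fin.last _) → i = 0 ∧ j = Fin.last _)
    {v : σ → R} (hv : (Matrix.of fun i j => v (e i j)) = 1)
    (hminor : Irreducible (Matrix.of fun i j : Fin (n + 1) =>
      (X (e i.succ j.castSucc) : MvPolynomial σ R)).det) :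
    Irreducible (Matrix.of fun i j => (X (e i j) : MvPolynomial σ R)).det := by
  set M : Matrix (Fin (n + 2)) (Fin (n + 2)) (MvPolynomial σ R) :=
    Matrix.of fun i j => X (e i j) with hM
  have hone : (aeval v : _ →ₐ[R] R).mapMatrix M = 1 := by
    rw [← hv]
    ext i j
    simp only [hM, AlgHom.mapMatrix_apply, Matrix.map_apply, Matrix.of_apply, aeval_X]
  refine irreducible_det_of_entry_eq_X (i := 0) (j := Fin.last _) rfl ?_ ?_ ?_
  · intro i j hx
    rw [hM, Matrix.of_apply, vars_X, Finset.mem_singleton] at hx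
    exact he i j hx.symm
  · rw [adjugate_last_zero, irreducible_isUnit_mul (isUnit_one.neg.pow _)]
    exact hminor
  · intro hdvd
    have hdvd' := map_dvd (aeval v : _ →ₐ[R] R) hdvd
    rw [AlgHom.map_det, hone, Matrix.det_one, ← Matrix.map_apply (f := aeval v),
      ← AlgHom.mapMatrix_apply, AlgHom.map_adjugate, hone, Matrix.adjugate_one,
      Matrix.one_apply_ne (Fin.last_pos).ne'] at hdvd'
    exact one_ne_zero (zero_dvd_iff.mp hdvd')

theorem irreducible_det_of_injective [IsDomain R] {n : ℕ} {e : Fin (n + 1) → Fin (n + 1) → σ}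
    (he : Function.Injective2 e) :
    Irreducible (Matrix.of fun i j => (X (e i j) : MvPolynomial σ R)).det := by
  classical
  induction n with
  | zero =>
    rw [Matrix.det_fin_one]
    exact X_prime.irreducible
  | succ n ih =>
    refine irreducible_det_of_corner e (fun i j h => he h)
      (v := fun x => if ∃ i, x = e i i then 1 else 0) ?_ (ih ?_)
    · ext i j
      rw [Matrix.of_apply, Matrix.one_apply]
      refine if_congr ⟨fun ⟨l, hl⟩ => ?_, fun h => ⟨i, by rw [h]⟩⟩ rfl rfl
      exact (he hl).1.trans (he hl).2.symm
    · intro i i' j j' h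
      exact (he h).imp (fun h => Fin.succ_injective _ h) fun h => Fin.castSucc_injective _ h

theorem irreducible_clonedDet (k : Type*) [Field k] {m : ℕ} (hm : 2 ≤ m) :
    Irreducible (clonedDet k m hm) := by
  obtain ⟨n, rfl⟩ := Nat.exists_eq_add_of_le' hm
  have hval {i j : Fin (n + 2)} (h : ¬(i.val + 1 = n + 2 ∧ j.val + 1 = n + 2)) :
      (cloneIndex hm i j).1 = (i, j) := by rw [cloneIndex, dif_neg h]
  rw [clonedDet, clonedMatrix_eq_cloneFill]
  refine irreducible_det_of_corner _ (fun i j h => ?_) (cloneFill_identityPoint hm)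
    (irreducible_det_of_injective fun i i' j j' h => ?_)
  · have hcorner := (congrArg Subtype.val h).trans (hval (by simp))
    by_cases hij : i.val + 1 = n + 2 ∧ j.val + 1 = n + 2
    · rw [cloneIndex, dif_pos hij, cloneSource_eq, Prod.mk.injEq] at hcorner
      have := congrArg Fin.val hcorner.2
      simp [sourceIndex] at this
    · rwa [hval hij, Prod.mk.injEq] at hcorner
  · have hminor (i j : Fin (n + 1)) : ¬(i.succ.val + 1 = n + 2 ∧ j.castSucc.val + 1 = n + 2) :=
      fun h => j.isLt.ne (by simpa using h.2)
    have heq := congrArg Subtype.val h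
    rw [hval (hminor _ _), hval (hminor _ _), Prod.mk.injEq] at heq
    exact heq.imp (fun h => Fin.succ_injective _ h) fun h => Fin.castSucc_injective _ h

end Irreducible

/-! ### Minimal systems of forms -/

section HomogeneousComponents

variable {R σ : Type*} [CommSemiring R] {s : ℕ} {S : Set (MvPolynomial σ R)}
  {p : MvPolynomial σ R}

theorem homogeneousComponent_mul_of_isHomogeneous {g : MvPolynomial σ R} (hg : g.IsHomogeneous s)
    (p : MvPolynomial σ R) (n : ℕ) :
    homogeneousComponent n (p * g) = if s ≤ n then homogeneousComponent (n - s) p * g else 0 := by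
  let := gradedAlgebra (σ := σ) (R := R)
  simp only [← decomposition.decompose'_apply]
  exact DirectSum.coe_decompose_mul_of_right_mem (homogeneousSubmodule σ R) n
    ((mem_homogeneousSubmodule s g).mpr hg)

theorem homogeneousComponent_eq_zero_of_mem_span (hS : ∀ g ∈ S, g.IsHomogeneous s)
    (hp : p ∈ Ideal.span S) {n : ℕ} (hn : n < s) : homogeneousComponent n p = 0 := by
  obtain ⟨c, hc, rfl⟩ := Submodule.mem_span_set.mp hp
  rw [Finsupp.sum, map_sum]
  refine Finset.sum_eq_zero fun g hg => ?_
  rw [smul_eq_mul, homogeneousComponent_mul_of_isHomogeneous (hS g (hc hg)),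
    if_neg hn.not_ge]

theorem homogeneousComponent_mem_span (hS : ∀ g ∈ S, g.IsHomogeneous s)
    (hp : p ∈ Ideal.span S) : homogeneousComponent s p ∈ Submodule.span R S := by
  obtain ⟨c, hc, rfl⟩ := Submodule.mem_span_set.mp hp
  rw [Finsupp.sum, map_sum]
  refine sum_mem fun g hg => ?_
  rw [smul_eq_mul, homogeneousComponent_mul_of_isHomogeneous (hS g (hc hg)), if_pos le_rfl,
    Nat.sub_self, homogeneousComponent_zero, ← smul_eq_C_mul]
  exact Submodule.smul_mem _ _ (Submodule.subset_span (hc hg))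

end HomogeneousComponents

section Forms

open scoped Matrix

theorem vecMul_map_C_injective {R σ ι κ : Type*} [CommSemiring R] [Fintype κ] {T : Matrix κ ι R}
    (hT : Function.Injective fun c => c ᵥ* T) :
    Function.Injective fun c => c ᵥ* T.map (C : R →+* MvPolynomial σ R) := by
  intro c d hcd
  ext j e
  have hcoeff : (fun j => coeff e (c j)) ᵥ* T = (fun j => coeff e (d j)) ᵥ* T := by
    funext i
    have hi := congrArg (coeff e) (congrFun hcd i)
    simpa only [Matrix.vecMul, dotProduct, Matrix.map_apply, coeff_sum, mul_comm _ (C _),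
      coeff_C_mul, mul_comm (T _ _)] using hi
  exact congrFun (hT hcoeff) j

variable {k σ ι κ : Type*} [Field k] {I : Ideal (MvPolynomial σ k)} {s s' : ℕ}
  {g : ι → MvPolynomial σ k} {g' : κ → MvPolynomial σ k}

theorem IsMinimalFormSystem.isHomogeneous_of_mem_range (hg : IsMinimalFormSystem I s g) :
    ∀ p ∈ Set.range g, p.IsHomogeneous s := by
  rintro _ ⟨i, rfl⟩
  exact hg.isHomogeneous i

theorem IsMinimalFormSystem.mem (hg : IsMinimalFormSystem I s g) (i : ι) : g i ∈ I := by
  rw [← hg.span_eq]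
  exact Ideal.subset_span ⟨i, rfl⟩

theorem IsMinimalFormSystem.linearIndependent (hg : IsMinimalFormSystem I s g) :
    LinearIndependent k g := by
  refine linearIndependent_iff_notMem_span.mpr fun i hi => hg.irredundant i ?_
  rw [← Set.compl_eq_univ_sdiff] at hi
  exact Submodule.span_le_restrictScalars k (MvPolynomial σ k) _ hi

theorem isMinimalFormSystem_of_linearIndependent (hg : LinearIndependent k g)
    (hs : ∀ i, (g i).IsHomogeneous s) : IsMinimalFormSystem (Ideal.span (Set.range g)) s g := by
  refine ⟨hs, rfl, fun i hi => linearIndependent_iff_notMem_span.mp hg i ?_⟩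
  rw [← Set.compl_eq_univ_sdiff, ← homogeneousComponent_eq_self (hs i)]
  refine homogeneousComponent_mem_span ?_ hi
  rintro _ ⟨j, -, rfl⟩
  exact hs j

theorem IsMinimalFormSystem.comp_equiv (hg : IsMinimalFormSystem I s g) (e : κ ≃ ι) :
    IsMinimalFormSystem I s (g ∘ e) := by
  rw [← hg.span_eq, ← e.surjective.range_comp g]
  exact isMinimalFormSystem_of_linearIndependent (hg.linearIndependent.comp e e.injective)
    fun i => hg.isHomogeneous (e i)

theorem IsMinimalFormSystem.degree_le [Nonempty κ] (hg : IsMinimalFormSystem I s g)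
    (hg' : IsMinimalFormSystem I s' g') : s ≤ s' := by
  obtain ⟨j⟩ := ‹Nonempty κ›
  by_contra! hlt
  refine hg'.linearIndependent.ne_zero j ?_
  rw [← homogeneousComponent_eq_self (hg'.isHomogeneous j)]
  exact homogeneousComponent_eq_zero_of_mem_span hg.isHomogeneous_of_mem_range
    (hg.span_eq ▸ hg'.mem j) hlt

theorem IsMinimalFormSystem.nonempty_index (hg : IsMinimalFormSystem I s g) (hI : I ≠ ⊥) :
    Nonempty ι := by
  by_contra! hι
  rw [← hg.span_eq, Set.range_eq_empty, Ideal.span_empty] at hI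
  exact hI rfl

theorem IsMinimalFormSystem.mem_span (hg : IsMinimalFormSystem I s g)
    (hg' : IsMinimalFormSystem I s' g') (j : κ) : g' j ∈ Submodule.span k (Set.range g) := by
  have : Nonempty κ := ⟨j⟩
  have hI : I ≠ ⊥ := fun hI =>
    hg'.linearIndependent.ne_zero j ((Submodule.mem_bot _).mp (hI ▸ hg'.mem j))
  have : Nonempty ι := hg.nonempty_index hI
  obtain rfl : s = s' := le_antisymm (hg.degree_le hg') (hg'.degree_le hg)
  rw [← homogeneousComponent_eq_self (hg'.isHomogeneous j)]
  exact homogeneousComponent_mem_span hg.isHomogeneous_of_mem_range (hg.span_eq ▸ hg'.mem j)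

theorem mem_syzygies [Fintype ι] {c : ι → MvPolynomial σ k} :
    c ∈ syzygies g ↔ c ⬝ᵥ g = 0 := Iff.rfl

theorem linearSyzygies_le_syzygies [Fintype ι] (g : ι → MvPolynomial σ k) :
    linearSyzygies g ≤ syzygies g :=
  Submodule.span_le.mpr fun _ hc => hc.1

theorem linearSyzygies_le_comap_vecMulLinear [Fintype ι] [Fintype κ] (T : Matrix κ ι k) :
    linearSyzygies (T.map C *ᵥ g) ≤
      (linearSyzygies g).comap (T.map (C : k →+* MvPolynomial σ k)).vecMulLinear := by
  refine Submodule.span_le.mpr fun c ⟨hc, hlin⟩ => Submodule.subset_span ⟨?_, fun i => ?_⟩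
  · rw [mem_syzygies, Matrix.vecMulLinear_apply, ← Matrix.dotProduct_mulVec]
    exact hc
  · refine IsHomogeneous.sum _ _ _ fun j _ => ?_
    rw [mul_comm]
    exact (hlin j).C_mul (T j i)

theorem finrank_linearSyzygies_le_of_mem_span [Finite σ] [Fintype ι] [Fintype κ]
    (hg' : LinearIndependent k g') (hspan : ∀ j, g' j ∈ Submodule.span k (Set.range g)) :
    Module.finrank (MvPolynomial σ k) (linearSyzygies g') ≤
      Module.finrank (MvPolynomial σ k) (linearSyzygies g) := by
  choose T hT using fun j => (Submodule.mem_span_range_iff_exists_fun k).mp (hspan j)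
  have hTg : (Matrix.of T).map C *ᵥ g = g' := by
    funext j
    rw [← hT j]
    simp only [Matrix.mulVec, dotProduct, Matrix.map_apply, Matrix.of_apply, smul_eq_C_mul]
  have hrows : LinearIndependent k T := by
    refine LinearIndependent.of_comp (Fintype.linearCombination k g) ?_
    convert hg' using 1
    exact funext hT
  have hinj := vecMul_map_C_injective (σ := σ) (Matrix.vecMul_injective_iff.mpr hrows)
  subst hTg
  refine LinearMap.finrank_le_finrank_of_injective
    (f := (Matrix.vecMulLinear _).restrict (linearSyzygies_le_comap_vecMulLinear (Matrix.of T))) ?_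
  exact fun c d hcd => Subtype.ext (hinj (congrArg Subtype.val hcd))

theorem IsMinimalFormSystem.finrank_linearSyzygies_eq [Finite σ] [Fintype ι] [Fintype κ]
    (hg : IsMinimalFormSystem I s g) (hg' : IsMinimalFormSystem I s' g') :
    Module.finrank (MvPolynomial σ k) (linearSyzygies g) =
      Module.finrank (MvPolynomial σ k) (linearSyzygies g') :=
  le_antisymm (finrank_linearSyzygies_le_of_mem_span hg.linearIndependent (hg'.mem_span hg))
    (finrank_linearSyzygies_le_of_mem_span hg'.linearIndependent (hg.mem_span hg'))

theorem finrank_ideal_eq_one {R : Type*} [CommRing R] [IsDomain R] [IsNoetherianRing R]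
    {J : Ideal R} (hJ : J ≠ ⊥) : Module.finrank R J = 1 := by
  have : Nontrivial J := Submodule.nontrivial_iff_ne_bot.mpr hJ
  exact le_antisymm ((Submodule.finrank_le J).trans_eq (Module.finrank_self R)) Module.finrank_pos

theorem finrank_syzygies_add_one [Finite σ] [Fintype ι] {i : ι} (hi : g i ≠ 0) :
    Module.finrank (MvPolynomial σ k) (syzygies g) + 1 = Fintype.card ι := by
  have hrange : LinearMap.range (Fintype.linearCombination (MvPolynomial σ k) g)
      = Ideal.span (Set.range g) := Fintype.range_linearCombination _ g
  have hne : Ideal.span (Set.range g) ≠ ⊥ := fun hbot =>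
    hi ((Submodule.mem_bot _).mp (hbot ▸ Ideal.subset_span (Set.mem_range_self i)))
  have hrank := (syzygies g).finrank_quotient_add_finrank
  rw [syzygies, (LinearMap.quotKerEquivRange _).finrank_eq, hrange, finrank_ideal_eq_one hne,
    Module.finrank_fintype_fun_eq_card] at hrank
  rw [← hrank, syzygies, add_comm]

theorem IsMinimalFormSystem.hasMaximalLinearRank [Finite σ] [Fintype ι]
    (hg : IsMinimalFormSystem I s g) {n : ℕ} (hn : Fintype.card ι = n + 1)
    (hrank : Module.finrank (MvPolynomial σ k) (linearSyzygies g) = n) :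
    HasLinearRank I n ∧ HasMaximalLinearRank I := by
  have hge := hg.comp_equiv (Fintype.equivFinOfCardEq hn).symm
  have hlin : HasLinearRank I n :=
    ⟨⟨_, s, _, hge⟩, fun _ _ _ hg' => (hg'.finrank_linearSyzygies_eq hg).trans hrank⟩
  refine ⟨hlin, n, s, _, hge, ?_, hlin⟩
  have hsyz := finrank_syzygies_add_one (hge.linearIndependent.ne_zero 0)
  rwa [Fintype.card_fin, Nat.add_right_cancel_iff] at hsyz

end Forms

/-! ### Linear syzygies of the partial derivatives -/

section InfinitesimalAction

variable {R A n : Type*} [CommRing R] [CommRing A] [Fintype n]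

/-- The infinitesimal action of the pair `(P, Q)` of `𝔤𝔩 × 𝔤𝔩` at the matrix `M`. -/
def infinitesimalAction (P Q M : Matrix n n A) : Matrix n n A := P * M + M * Q

theorem map_infinitesimalAction (φ : R →+* A) (P Q M : Matrix n n R) :
    (infinitesimalAction P Q M).map φ
      = infinitesimalAction (P.map φ) (Q.map φ) (M.map φ) := by
  rw [infinitesimalAction, Matrix.map_add _ (map_add φ), Matrix.map_mul, Matrix.map_mul,
    infinitesimalAction]

theorem isHomogeneous_infinitesimalAction {σ : Type*} (P Q : Matrix n n R)
    {M : Matrix n n (MvPolynomial σ R)} {d : ℕ} (hM : ∀ i j, (M i j).IsHomogeneous d) (i j : n) :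
    (infinitesimalAction (P.map C) (Q.map C) M i j).IsHomogeneous d := by
  rw [infinitesimalAction, Matrix.add_apply, Matrix.mul_apply, Matrix.mul_apply]
  refine (IsHomogeneous.sum _ _ _ fun l _ => ?_).add (IsHomogeneous.sum _ _ _ fun l _ => ?_)
  · exact (hM l j).C_mul (P i l)
  · rw [mul_comm]
    exact (hM i l).C_mul (Q l j)

variable [DecidableEq n]

theorem trace_infinitesimalAction_mul_adjugate (P Q M : Matrix n n A) :
    (infinitesimalAction P Q M * M.adjugate).trace = (P + Q).trace * M.det := by
  rw [infinitesimalAction, Matrix.add_mul, Matrix.mul_assoc, Matrix.mul_adjugate,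
    Matrix.trace_add, Matrix.trace_mul_cycle, Matrix.adjugate_mul, Matrix.mul_smul,
    Matrix.smul_mul, Matrix.mul_one, Matrix.one_mul, Matrix.trace_smul, Matrix.trace_smul,
    Matrix.trace_add, smul_eq_mul, smul_eq_mul]
  ring

/-- A matrix of trace zero which agrees with twice the matrix unit at `(i, j)` outside the slots
`(s, s)` and `(l, l)`. -/
def tracelessUnit (R : Type*) [CommRing R] (s l i j : n) : Matrix n n R :=
  2 • Matrix.single i j 1 - if i = j then Matrix.single s s 1 + Matrix.single l l 1 else 0

theorem trace_tracelessUnit (s l i j : n) : (tracelessUnit R s l i j).trace = 0 := by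
  rw [tracelessUnit, Matrix.trace_sub, Matrix.trace_smul]
  split_ifs with hij
  · rw [hij, Matrix.trace_add, Matrix.trace_single_eq_same, Matrix.trace_single_eq_same,
      Matrix.trace_single_eq_same]
    norm_num
  · rw [Matrix.trace_single_eq_of_ne _ _ _ hij, smul_zero, Matrix.trace_zero, sub_zero]

/-- The unit at `(i, j)` acts from the left only on row `i` and from the right only on column `j`,
so one side suffices to leave both slots alone, unless `(i, j)` is `(s, l)` or `(l, s)`;
there, acting from both sides changes the two slots by the same amount. -/
theorem exists_add_eq_tracelessUnit (f : R →+* A) {s l i j : n} (hsl : s ≠ l)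
    (hs : ¬(i = s ∧ j = s)) (hl : ¬(i = l ∧ j = l)) :
    ∃ P Q : Matrix n n R, P + Q = tracelessUnit R s l i j ∧
      ∀ M : Matrix n n A, M s s = M l l →
        infinitesimalAction (P.map f) (Q.map f) M s s
          = infinitesimalAction (P.map f) (Q.map f) M l l := by
  by_cases hi : i = s ∨ i = l
  · have hij : i ≠ j := by
      rintro rfl
      exact hi.elim (fun h => hs ⟨h, h⟩) fun h => hl ⟨h, h⟩
    by_cases hj : j = s ∨ j = l
    · refine ⟨Matrix.single i j 1, Matrix.single i j 1, ?_, fun M hM => ?_⟩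
      · rw [tracelessUnit, if_neg hij, sub_zero, two_smul]
      · rcases hi with rfl | rfl <;> rcases hj with rfl | rfl <;>
          simp_all [infinitesimalAction]
    · push Not at hj
      refine ⟨0, 2 • Matrix.single i j 1, ?_, fun M _ => ?_⟩
      · rw [tracelessUnit, if_neg hij, sub_zero, zero_add]
      · simp [infinitesimalAction, hj.1.symm, hj.2.symm]
  · push Not at hi
    refine ⟨tracelessUnit R s l i j, 0, add_zero _, fun M hM => ?_⟩
    by_cases hij : i = j
    · subst hij
      simp [infinitesimalAction, tracelessUnit, Matrix.map_sub, Matrix.map_add, Matrix.map_single,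
        Matrix.sub_mul, Matrix.add_mul, hi.1.symm, hi.2.symm, hsl, hsl.symm, hM]
    · simp [infinitesimalAction, tracelessUnit, hij, hi.1.symm, hi.2.symm]

end InfinitesimalAction

section Syzygies

theorem card_le_finrank_of_det_map_ne_zero {R S ι κ : Type*} [CommRing R] [IsDomain R]
    [IsNoetherianRing R] [CommRing S] [Finite ι] [Fintype κ] [DecidableEq κ] (φ : R →+* S)
    {L : Submodule R (ι → R)} {c : κ → ι → R} (hc : ∀ a, c a ∈ L) (u : κ → ι)
    (hdet : (Matrix.of fun a b => φ (c a (u b))).det ≠ 0) :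
    Fintype.card κ ≤ Module.finrank R L := by
  let N : Matrix κ κ R := Matrix.of fun a b => c a (u b)
  have hN : N.det ≠ 0 := fun h => hdet <| by
    rw [← map_zero φ, ← h, RingHom.map_det]
    rfl
  have hind : LinearIndependent R fun a => (⟨c a, hc a⟩ : L) :=
    LinearIndependent.of_comp ((LinearMap.funLeft R R u).comp L.subtype)
      (Matrix.linearIndependent_rows_of_det_ne_zero hN)
  exact hind.fintype_card_le_finrank

theorem card_cloneVar {m : ℕ} (hm : 2 ≤ m) : Fintype.card (CloneVar m) = m ^ 2 - 1 := by
  have hsum := sum_eq_sum_cloneVar_add hm fun _ _ => (1 : ℤ)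
  simp only [Finset.sum_const, Finset.card_univ, Fintype.card_fin, mul_one,
    nsmul_eq_mul] at hsum
  have : m ^ 2 = Fintype.card (CloneVar m) + 1 := by
    rw [sq]
    exact_mod_cast hsum
  omega

theorem sum_restrict_infinitesimalAction_mul_polarPoint {A : Type*} [CommRing A] {m : ℕ}
    (hm : 2 ≤ m) (P Q : Matrix (Fin m) (Fin m) A) (v : CloneVar m → A)
    (hbal : infinitesimalAction P Q (cloneFill hm v) (sourceIndex hm) (sourceIndex hm)
      = infinitesimalAction P Q (cloneFill hm v) (targetIndex hm) (targetIndex hm)) :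
    ∑ p, restrict (infinitesimalAction P Q (cloneFill hm v)) p * polarPoint hm v p
      = (P + Q).trace * (cloneFill hm v).det := by
  rw [polarPoint, ← sum_cloneFill_mul, cloneFill_restrict hm hbal,
    ← trace_infinitesimalAction_mul_adjugate]
  simp only [Matrix.trace, Matrix.diag_apply, Matrix.mul_apply, cofactorMatrix,
    Matrix.transpose_apply]

variable {k : Type*} [Field k] {m : ℕ} (hm : 2 ≤ m)

theorem tracelessUnit_cloneVar {p q : CloneVar m} (hq : q ≠ cloneSource m hm) :
    tracelessUnit k (sourceIndex hm) (targetIndex hm) p.1.1 p.1.2 q.1.1 q.1.2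
      = if p = q then 2 else 0 := by
  have hs : ¬(sourceIndex hm = q.1.1 ∧ sourceIndex hm = q.1.2) := fun h =>
    hq (Subtype.ext (Prod.ext h.1.symm h.2.symm))
  have hl : ¬(targetIndex hm = q.1.1 ∧ targetIndex hm = q.1.2) := fun h =>
    q.2 ⟨(eq_targetIndex_iff hm _).mp h.1.symm, (eq_targetIndex_iff hm _).mp h.2.symm⟩
  have hpq : p = q ↔ p.1.1 = q.1.1 ∧ p.1.2 = q.1.2 := by
    rw [Subtype.ext_iff, Prod.ext_iff]
  simp only [tracelessUnit, Matrix.sub_apply, Matrix.smul_apply, Matrix.single_apply, hpq]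
  split_ifs <;> simp [hs, hl]

theorem exists_linear_syzygy_of_ne_cloneSource {p : CloneVar m} (hp : p ≠ cloneSource m hm) :
    ∃ c ∈ linearSyzygies (polarMap (clonedDet k m hm)), ∀ q, q ≠ cloneSource m hm →
      aeval (identityPoint k m) (c q) = if p = q then (2 : k) else 0 := by
  have hs : ¬(p.1.1 = sourceIndex hm ∧ p.1.2 = sourceIndex hm) := fun h =>
    hp (Subtype.ext (Prod.ext h.1 h.2))
  have hl : ¬(p.1.1 = targetIndex hm ∧ p.1.2 = targetIndex hm) := fun h =>
    p.2 (h.imp (eq_targetIndex_iff hm _).mp (eq_targetIndex_iff hm _).mp)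
  obtain ⟨P, Q, hPQ, hbal⟩ := exists_add_eq_tracelessUnit (R := k)
    (C : k →+* MvPolynomial (CloneVar m) k) (sourceIndex_ne_targetIndex hm) hs hl
  refine ⟨restrict (infinitesimalAction (P.map C) (Q.map C) (cloneFill hm X)),
    Submodule.subset_span ⟨?_, fun q => ?_⟩, fun q hq => ?_⟩
  · rw [mem_syzygies, polarMap_clonedDet]
    refine (sum_restrict_infinitesimalAction_mul_polarPoint hm _ _ X
      (hbal _ (cloneFill_source_eq_target hm X))).trans ?_
    rw [← Matrix.map_add _ (map_add C), hPQ, ← AddMonoidHom.map_trace, trace_tracelessUnit,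
      map_zero, zero_mul]
  · exact isHomogeneous_infinitesimalAction P Q (isHomogeneous_cloneFill_X k hm) _ _
  · have heval : (infinitesimalAction (P.map C) (Q.map C) (cloneFill hm X)).map
        (aeval (identityPoint k m)) = P + Q := by
      have hC : ∀ N : Matrix (Fin m) (Fin m) k,
          (N.map (C : k →+* MvPolynomial (CloneVar m) k)).map (aeval (identityPoint k m)) = N :=
        fun N => by ext; simp
      rw [← AlgHom.coe_toRingHom, map_infinitesimalAction]
      simp only [AlgHom.coe_toRingHom, hC, cloneFill_map_aeval_identityPoint, infinitesimalAction,
        mul_one, one_mul]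
    rw [← tracelessUnit_cloneVar hm hq, ← hPQ, ← heval]
    rfl

theorem finrank_linearSyzygies_clonedDet (h2 : (2 : k) ≠ 0) :
    Module.finrank (MvPolynomial (CloneVar m) k) (linearSyzygies (polarMap (clonedDet k m hm)))
      = m ^ 2 - 2 := by
  classical
  have hcard := card_cloneVar hm
  refine le_antisymm ?_ ?_
  · have hsyz := finrank_syzygies_add_one
      ((linearIndependent_polarMap_clonedDet hm h2).ne_zero (cloneSource m hm))
    have hmono := Submodule.finrank_mono (linearSyzygies_le_syzygies (polarMap (clonedDet k m hm)))
    omega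
  · choose! c hc hev using fun p => exists_linear_syzygy_of_ne_cloneSource (k := k) hm (p := p)
    have hle := card_le_finrank_of_det_map_ne_zero
      (κ := {p : CloneVar m // p ≠ cloneSource m hm})
      (aeval (identityPoint k m) : _ →ₐ[k] k).toRingHom
      (fun p => hc p.1 p.2) Subtype.val ?_
    · rw [Fintype.card_subtype_compl, Fintype.card_subtype_eq, hcard, Nat.sub_sub] at hle
      exact hle
    · have hdiag : (Matrix.of fun a b : {p : CloneVar m // p ≠ cloneSource m hm} =>
          aeval (identityPoint k m) (c a.1 b.1)) = Matrix.diagonal fun _ => (2 : k) := by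
        ext a b
        rw [Matrix.of_apply, hev a.1 a.2 b.1 b.2, Matrix.diagonal_apply]
        simp only [Subtype.ext_iff]
      refine ne_of_eq_of_ne (congrArg Matrix.det hdiag) ?_
      rw [Matrix.det_diagonal]
      exact Finset.prod_ne_zero_iff.mpr fun _ _ => h2

theorem linearRank_gradientIdeal_clonedDet (h2 : (2 : k) ≠ 0) :
    HasLinearRank (gradientIdeal (clonedDet k m hm)) (m ^ 2 - 2) ∧
      HasMaximalLinearRank (gradientIdeal (clonedDet k m hm)) := by
  refine (isMinimalFormSystem_of_linearIndependent (linearIndependent_polarMap_clonedDet hm h2)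
    (isHomogeneous_polarMap_clonedDet k hm)).hasMaximalLinearRank ?_
    (finrank_linearSyzygies_clonedDet hm h2)
  have : 2 ^ 2 ≤ m ^ 2 := Nat.pow_le_pow_left hm 2
  rw [card_cloneVar hm]
  omega

end Syzygies

end Cloning

theorem theorem2p3_general {k : Type*} [Field k] (m : ℕ) (hm : 2 ≤ m) (h2 : (2 : k) ≠ 0)
    (hm1 : ((m - 1 : ℕ) : k) ≠ 0) :
    Irreducible (Cloning.clonedDet k m hm) ∧
    (Cloning.hessian (Cloning.clonedDet k m hm)).det ≠ 0 ∧
    (Cloning.HasLinearRank (Cloning.gradientIdeal (Cloning.clonedDet k m hm)) (m ^ 2 - 2) ∧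
      Cloning.HasMaximalLinearRank (Cloning.gradientIdeal (Cloning.clonedDet k m hm))) ∧
    Cloning.IsHomaloidal (Cloning.clonedDet k m hm) :=
  ⟨Cloning.irreducible_clonedDet k hm, Cloning.det_hessian_clonedDet_ne_zero hm h2 hm1,
    Cloning.linearRank_gradientIdeal_clonedDet hm h2, Cloning.isHomaloidal_clonedDet hm h2⟩

theorem theorem2p3 {k : Type*} [Field k] [CharZero k] (m : ℕ) (hm : 2 ≤ m) :
    Irreducible (Cloning.clonedDet k m hm) ∧
    (Cloning.hessian (Cloning.clonedDet k m hm)).det ≠ 0 ∧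
    (Cloning.HasLinearRank (Cloning.gradientIdeal (Cloning.clonedDet k m hm)) (m ^ 2 - 2) ∧
      Cloning.HasMaximalLinearRank (Cloning.gradientIdeal (Cloning.clonedDet k m hm))) ∧
    Cloning.IsHomaloidal (Cloning.clonedDet k m hm) := by
  exact theorem2p3_general m hm two_ne_zero (Nat.cast_ne_zero.mpr (by omega))
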